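/- Let $k$ be a field and let $G$ be a finite simple graph with non-empty vertex set $V=\{x_1,\dots,x_n\}$ and without isolated vertices. Let $J(G)\subset R=k[x_1,\dots,x_n]$ be its cover ideal, i.e. the ideal generated by the monomials $\prod_{x\in C}x$, where $C\subseteq V$ runs over the vertex covers of $G$. For an ideal $I\subset R$ and $s\ge 0$ let $I^{(s)}=\bigcap_{P\in\operatorname{Ass}(R/I)}(I^sR_P\cap R)$ be its $s$-th symbolic power, and let $$\rho(I)=\sup\Big\{\tfrac st : s,t\ge 1,\ I^{(s)}\not\subseteq I^t\Big\},\qquad \rho_a(I)=\sup\Big\{\tfrac st : s,t\ge 1,\ I^{(sr)}\not\subseteq I^{tr}\text{ for all } r\gg 0\Big\}$$ be its resurgence and asymptotic resurgence. Let $\omega(G)$, $\alpha(G)$ and $\chi(G)$ denote the clique number, the independence number and the chromatic number of $G$. (1) If $G$ is connected, then $$\max\Big\{2-\frac{2}{\omega(G)},\ 2-\frac{2\alpha(G)}{n}\Big\}\le\rho_a(J(G))\le\rho(J(G))\le 2-\frac{2}{\chi(G)}.$$ (2) If $\chi(G)=\omega(G)$ (with $G$ not necessarily connected), then $\rho_a(J(G))=\rho(J(G))=2-\frac{2}{\omega(G)}$.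 In particular, this holds if $G$ is perfect, i.e. if $\chi(G[A])=\omega(G[A])$ for every $A\subseteq V$, where $G[A]$ is the subgraph of $G$ induced on $A$. -/

import Mathlib

/-- The set `Ass(R/I)` of associated primes of an ideal `I`, as a set of ideals of `R`. -/
def assPrimes {R : Type*} [CommRing R] (I : Ideal R) : Set (Ideal R) :=
  associatedPrimes R (R ⧸ I)

/-- The contraction `I R_P ∩ R` to `R` of the extension of `I` to the localization `R_P`. -/
def localContraction {R : Type*} [CommRing R] (I P : Ideal R) [P.IsPrime] : Ideal R :=
  (I.map (algebraMap R (Localization.AtPrime P))).comap (algebraMap R (Localization.AtPrime P))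

/-- The `s`-th symbolic power `I^(s) = ⋂_{P ∈ Ass(R/I)} (I^s R_P ∩ R)`. -/
def symbolicPower {R : Type*} [CommRing R] (I : Ideal R) (s : ℕ) : Ideal R :=
  ⨅ (P : Ideal R) (hP : P ∈ assPrimes I),
    haveI : P.IsPrime := IsAssociatedPrime.isPrime hP
    localContraction (I ^ s) P

/-- The resurgence `ρ(I) = sup {s / t : s, t ≥ 1, I^(s) ⊄ I^t}`, as an extended real number
(so the supremum always exists). -/
noncomputable def resurgence {R : Type*} [CommRing R] (I : Ideal R) : EReal :=
  sSup {q : EReal | ∃ s t : ℕ, 0 < s ∧ 0 < t ∧ ¬ symbolicPower I s ≤ I ^ t ∧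
    q = (((s : ℝ) / (t : ℝ) : ℝ) : EReal)}

/-- The asymptotic resurgence
`ρ_a(I) = sup {s / t : s, t ≥ 1, I^(s r) ⊄ I^(t r) for all sufficiently large r}`,
as an extended real number. -/
noncomputable def asymptoticResurgence {R : Type*} [CommRing R] (I : Ideal R) : EReal :=
  sSup {q : EReal | ∃ s t : ℕ, 0 < s ∧ 0 < t ∧
    (∀ᶠ r : ℕ in Filter.atTop, ¬ symbolicPower I (s * r) ≤ I ^ (t * r)) ∧
    q = (((s : ℝ) / (t : ℝ) : ℝ) : EReal)}

/-- The cover ideal `J(G)` in the polynomial ring over `k` whose variables are the vertices of `G`: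
it is generated by the squarefree monomials supported on the vertex covers of `G`. -/
noncomputable def coverIdeal (k : Type*) [Field k] {V : Type*} (G : SimpleGraph V) :
    Ideal (MvPolynomial V k) :=
  Ideal.span {f | ∃ C : Finset V, G.IsVertexCover (C : Set V) ∧
    f = ∏ x ∈ C, (MvPolynomial.X x : MvPolynomial V k)}

/-- `G` is perfect: every induced subgraph has chromatic number equal to its clique number. -/
def IsPerfectGraph {V : Type*} (G : SimpleGraph V) : Prop :=
  ∀ A : Set V, (G.induce A).chromaticNumber = ((G.induce A).cliqueNum : ℕ∞)

open Polynomial in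
/-- The `k`-algebra map sending `X v` to `X v * T` for `v ∈ A` and to `X v` otherwise. -/
noncomputable def scaleHom (k : Type*) [Field k] {V : Type*} (A : Finset V) :
    MvPolynomial V k →ₐ[k] (MvPolynomial V k)[X] :=
  open Classical in
  MvPolynomial.aeval fun v =>
    Polynomial.C (MvPolynomial.X v) * (if v ∈ A then Polynomial.X else 1)

section scaleHom

variable {k : Type*} [Field k] {V : Type*}

lemma scaleHom_X_of_mem {A : Finset V} {v : V} (hv : v ∈ A) :
    scaleHom k A (MvPolynomial.X v) = Polynomial.C (MvPolynomial.X v) * Polynomial.X := by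
  simp [scaleHom, hv]

lemma scaleHom_X_of_notMem {A : Finset V} {v : V} (hv : v ∉ A) :
    scaleHom k A (MvPolynomial.X v) = Polynomial.C (MvPolynomial.X v) := by
  simp [scaleHom, hv]

lemma scaleHom_monomial [Fintype V] (A : Finset V) (m : V →₀ ℕ) (c : k) :
    scaleHom k A (MvPolynomial.monomial m c) =
      Polynomial.C (MvPolynomial.monomial m c) * Polynomial.X ^ (∑ v ∈ A, m v) := by
  classical
  have hX : ∀ v, scaleHom k A (MvPolynomial.X v) =
      Polynomial.C (MvPolynomial.X v) * (if v ∈ A then Polynomial.X else 1) := by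
    intro v
    split_ifs with h
    · exact scaleHom_X_of_mem h
    · rw [scaleHom_X_of_notMem h, mul_one]
  have hC : scaleHom k A (MvPolynomial.C c) = Polynomial.C (MvPolynomial.C c) := by
    rw [← MvPolynomial.algebraMap_eq, AlgHom.commutes]
    rfl
  rw [MvPolynomial.monomial_eq, Finsupp.prod_fintype _ _ (fun _ => pow_zero _), map_mul, hC,
    map_prod, map_mul, map_prod, mul_assoc]
  congr 1
  simp only [map_pow, hX, mul_pow, Finset.prod_mul_distrib]
  congr 1
  rw [← Finset.prod_pow_eq_pow_sum, ← Finset.prod_subset (Finset.subset_univ A)]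
  · exact Finset.prod_congr rfl fun v hv => by rw [if_pos hv]
  · intro v _ hv
    rw [if_neg hv, one_pow]

lemma coeff_coeff_scaleHom [Fintype V] (A : Finset V) (f : MvPolynomial V k) (m : V →₀ ℕ) :
    ((scaleHom k A f).coeff (∑ v ∈ A, m v)).coeff m = f.coeff m := by
  classical
  induction f using MvPolynomial.induction_on' with
  | monomial a c =>
    rw [scaleHom_monomial, Polynomial.coeff_C_mul_X_pow]
    by_cases h : a = m
    · subst h; simp
    · split_ifs <;> simp [MvPolynomial.coeff_monomial, h]
  | add p q hp hq => simp [hp, hq]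

lemma le_sum_of_X_pow_dvd_scaleHom [Fintype V] {A : Finset V} {f : MvPolynomial V k} {s : ℕ}
    (h : Polynomial.X ^ s ∣ scaleHom k A f) {m : V →₀ ℕ} (hm : m ∈ f.support) :
    s ≤ ∑ v ∈ A, m v := by
  by_contra! hlt
  rw [MvPolynomial.mem_support_iff, ← coeff_coeff_scaleHom A,
    Polynomial.X_pow_dvd_iff.1 h _ hlt] at hm
  exact hm (MvPolynomial.coeff_zero m)

lemma X_pow_dvd_scaleHom_prod {A C : Finset V} [DecidableEq V] {d : ℕ}
    (h : d ≤ (A ∩ C).card) :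
    Polynomial.X ^ d ∣ scaleHom k A (∏ v ∈ C, MvPolynomial.X v) := by
  rw [map_prod]
  refine (pow_dvd_pow _ h).trans ?_
  rw [← Finset.prod_const]
  refine (Finset.prod_dvd_prod_of_dvd _ _ fun v hv => ?_).trans
    (Finset.prod_dvd_prod_of_subset _ _ _ Finset.inter_subset_right)
  rw [scaleHom_X_of_mem (Finset.mem_inter.1 hv).1]
  exact dvd_mul_left _ _

end scaleHom

/-- The prime ideal of `k[V]` generated by the variables in `A`, as a contraction. -/
noncomputable def variablesIdeal (k : Type*) [Field k] {V : Type*} (A : Finset V) :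
    Ideal (MvPolynomial V k) :=
  (Ideal.span {Polynomial.X}).comap (scaleHom k A)

section CoverIdeal

variable {k : Type*} [Field k] {V : Type*}

lemma mem_variablesIdeal {A : Finset V} {f : MvPolynomial V k} :
    f ∈ variablesIdeal k A ↔ Polynomial.X ∣ scaleHom k A f := by
  rw [variablesIdeal, Ideal.mem_comap, Ideal.mem_span_singleton]

instance isPrime_variablesIdeal (A : Finset V) : (variablesIdeal k A).IsPrime := by
  have : (Ideal.span {(Polynomial.X : Polynomial (MvPolynomial V k))}).IsPrime :=
    (Ideal.span_singleton_prime Polynomial.X_ne_zero).2 Polynomial.prime_X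
  exact Ideal.comap_isPrime _ _

lemma X_mem_variablesIdeal_iff {A : Finset V} {v : V} :
    MvPolynomial.X v ∈ variablesIdeal k A ↔ v ∈ A := by
  rw [mem_variablesIdeal]
  by_cases hv : v ∈ A
  · simp [scaleHom_X_of_mem hv, hv]
  · simp [scaleHom_X_of_notMem hv, hv, Polynomial.X_dvd_iff]

lemma prod_compl_notMem_variablesIdeal [Fintype V] [DecidableEq V] (A : Finset V) :
    ∏ v ∈ Aᶜ, MvPolynomial.X v ∉ variablesIdeal k A := by
  intro h
  obtain ⟨v, hv, hvA⟩ := (isPrime_variablesIdeal A).prod_mem_iff.1 h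
  exact Finset.mem_compl.1 hv (X_mem_variablesIdeal_iff.1 hvA)

variable {G : SimpleGraph V}

lemma prod_mem_coverIdeal {C : Finset V} (hC : G.IsVertexCover (C : Set V)) :
    ∏ v ∈ C, MvPolynomial.X v ∈ coverIdeal k G :=
  Ideal.subset_span ⟨C, hC, rfl⟩

/-- If every vertex cover meets `A` in at least `d` vertices, the `t`-th power of the cover
ideal consists of polynomials of order at least `d * t` along `A`. -/
lemma X_pow_dvd_of_mem_coverIdeal_pow [DecidableEq V] {A : Finset V} {d t : ℕ}
    (h : ∀ C : Finset V, G.IsVertexCover (C : Set V) → d ≤ (A ∩ C).card)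
    {f : MvPolynomial V k} (hf : f ∈ coverIdeal k G ^ t) :
    Polynomial.X ^ (d * t) ∣ scaleHom k A f := by
  have h1 : (coverIdeal k G).map (scaleHom k A) ≤ Ideal.span {Polynomial.X ^ d} := by
    rw [coverIdeal, Ideal.map_span, Ideal.span_le]
    rintro _ ⟨_, ⟨C, hC, rfl⟩, rfl⟩
    exact Ideal.mem_span_singleton.2 (X_pow_dvd_scaleHom_prod (h C hC))
  have h2 := Ideal.pow_right_mono h1 t (by
    rw [← Ideal.map_pow]; exact Ideal.mem_map_of_mem _ hf)
  rwa [Ideal.span_singleton_pow, Ideal.mem_span_singleton, ← pow_mul] at h2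

lemma one_le_card_edge_inter [DecidableEq V] {i j : V} (hij : G.Adj i j) (C : Finset V)
    (hC : G.IsVertexCover (C : Set V)) : 1 ≤ (({i, j} : Finset V) ∩ C).card := by
  rw [Finset.one_le_card]
  rcases hC hij with h | h
  · exact ⟨i, by simpa using h⟩
  · exact ⟨j, by simpa using h⟩

lemma coverIdeal_le_variablesIdeal [DecidableEq V] {i j : V} (hij : G.Adj i j) :
    coverIdeal k G ≤ variablesIdeal k {i, j} := by
  intro f hf
  rw [mem_variablesIdeal]
  simpa using X_pow_dvd_of_mem_coverIdeal_pow (t := 1) (one_le_card_edge_inter hij)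
    (by simpa using hf)

lemma prod_erase_mem_coverIdeal [Fintype V] [DecidableEq V] (j : V) :
    ∏ v ∈ Finset.univ.erase j, MvPolynomial.X v ∈ coverIdeal k G := by
  refine prod_mem_coverIdeal fun u v huv => ?_
  by_cases h : u = j
  · right; simpa [← h] using huv.ne'
  · left; simpa using h

lemma X_mul_prod_compl_mem_coverIdeal [Fintype V] [DecidableEq V] {i j v : V}
    (hij : i ≠ j) (hv : v ∈ ({i, j} : Finset V)) :
    MvPolynomial.X v * ∏ u ∈ ({i, j} : Finset V)ᶜ, MvPolynomial.X u ∈ coverIdeal k G := by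
  have key : ∀ a b : V, a ≠ b → MvPolynomial.X a * ∏ u ∈ ({a, b} : Finset V)ᶜ, MvPolynomial.X u
      ∈ coverIdeal k G := by
    intro a b hab
    rw [← Finset.prod_insert (by simp)]
    convert prod_erase_mem_coverIdeal b using 2
    ext u
    by_cases h : u = a <;> simp_all
  rw [Finset.mem_insert, Finset.mem_singleton] at hv
  rcases hv with rfl | rfl
  · exact key _ _ hij
  · rw [Finset.pair_comm]; exact key _ _ hij.symm

/-- If each vertex `v` belongs to all but at most `m v` of `t` independent sets, then the monomial
`m` lies in the `t`-th power of the cover ideal; here `T v` indexes the sets containing `v`. -/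
lemma monomial_mem_coverIdeal_pow [Fintype V] [DecidableEq V] {t : ℕ} (T : V → Finset ℕ)
    (hT : ∀ v, T v ⊆ Finset.range t) (hdisj : ∀ u v, G.Adj u v → Disjoint (T u) (T v))
    (m : V →₀ ℕ) (hm : ∀ v, t ≤ m v + (T v).card) (c : k) :
    MvPolynomial.monomial m c ∈ coverIdeal k G ^ t := by
  have h1 : ∏ q ∈ Finset.range t, ∏ v with q ∉ T v, (MvPolynomial.X v : MvPolynomial V k)
      ∈ coverIdeal k G ^ t := by
    have h := Ideal.prod_mem_prod (s := Finset.range t) (I := fun _ => coverIdeal k G)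
      (x := fun q => ∏ v with q ∉ T v, (MvPolynomial.X v : MvPolynomial V k)) fun q _ =>
        prod_mem_coverIdeal (G := G) (C := Finset.univ.filter fun v => q ∉ T v) fun u v huv => by
          by_contra! hq
          simp only [Finset.coe_filter, Finset.mem_univ, true_and, Set.mem_ofPred_eq,
            not_not] at hq
          exact Finset.disjoint_left.1 (hdisj u v huv) hq.1 hq.2
    simpa using h
  have h2 : ∏ q ∈ Finset.range t, ∏ v with q ∉ T v, (MvPolynomial.X v : MvPolynomial V k) =
      ∏ v, MvPolynomial.X v ^ (Finset.range t \ T v).card := by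
    simp_rw [Finset.prod_filter]
    rw [Finset.prod_comm]
    refine Finset.prod_congr rfl fun v _ => ?_
    rw [← Finset.prod_filter, Finset.prod_const, Finset.filter_notMem_eq_sdiff]
  rw [MvPolynomial.monomial_eq, Finsupp.prod_fintype _ _ (fun _ => pow_zero _)]
  refine Ideal.mul_mem_left _ _ (Ideal.mem_of_dvd _ ?_ (h2 ▸ h1))
  refine Finset.prod_dvd_prod_of_dvd _ _ fun v _ => pow_dvd_pow _ ?_
  rw [Finset.card_sdiff_of_subset (hT v), Finset.card_range]
  exact Nat.sub_le_iff_le_add.2 (hm v)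

lemma mem_of_forall_monomial_mem {I : Ideal (MvPolynomial V k)} {f : MvPolynomial V k}
    (h : ∀ m ∈ f.support, MvPolynomial.monomial m (f.coeff m) ∈ I) : f ∈ I := by
  rw [f.as_sum]
  exact I.sum_mem h

lemma mem_coverIdeal_of_forall_edge [Fintype V] [DecidableEq V] {f : MvPolynomial V k}
    (h : ∀ i j, G.Adj i j → f ∈ variablesIdeal k {i, j}) : f ∈ coverIdeal k G := by
  refine mem_of_forall_monomial_mem fun m hm => ?_
  rw [← pow_one (coverIdeal k G)]
  refine monomial_mem_coverIdeal_pow (fun v => if m v = 0 then {0} else ∅) ?_ ?_ m ?_ _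
  · intro v; split_ifs <;> simp
  · intro u v huv
    have h1 := le_sum_of_X_pow_dvd_scaleHom (s := 1) (A := {u, v})
      (by simpa using mem_variablesIdeal.1 (h u v huv)) hm
    rw [Finset.sum_pair huv.ne] at h1
    split_ifs <;> simp
    omega
  · intro v
    split_ifs with hv
    · simp
    · simp; omega

lemma mem_assPrimes_iff {R : Type*} [CommRing R] [IsNoetherianRing R] {I P : Ideal R} :
    P ∈ assPrimes I ↔ P.IsPrime ∧ ∃ f, ∀ g, g ∈ P ↔ g * f ∈ I := by
  rw [assPrimes, AssociatedPrimes.mem_iff, isAssociatedPrime_iff]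
  refine and_congr_right fun _ => ?_
  rw [(Ideal.Quotient.mk_surjective (I := I)).exists]
  refine exists_congr fun f => ?_
  rw [SetLike.ext_iff]
  refine forall_congr' fun g => ?_
  rw [Submodule.mem_colon_singleton, Submodule.mem_bot, ← Ideal.Quotient.eq_zero_iff_mem (I := I),
    map_mul]
  rfl

lemma variablesIdeal_mem_assPrimes [Fintype V] [DecidableEq V] {i j : V} (hij : G.Adj i j) :
    variablesIdeal k {i, j} ∈ assPrimes (coverIdeal k G) := by
  refine mem_assPrimes_iff.2 ⟨inferInstance, ∏ v ∈ ({i, j} : Finset V)ᶜ, MvPolynomial.X v,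
    fun f => ⟨fun hf => mem_coverIdeal_of_forall_edge fun a b hab => ?_, fun hf =>
      ((isPrime_variablesIdeal _).mem_or_mem (coverIdeal_le_variablesIdeal hij hf)).resolve_right
        (prod_compl_notMem_variablesIdeal _)⟩⟩
  by_cases hsub : ({i, j} : Finset V) = {a, b}
  · rw [← hsub]
    exact Ideal.mul_mem_right _ _ hf
  · have hex : ∃ v ∈ ({a, b} : Finset V), v ∈ ({i, j} : Finset V)ᶜ := by
      by_contra! hno
      refine hsub (Finset.eq_of_subset_of_card_le
        (fun v hv => by simpa [or_iff_not_imp_left] using hno v hv) ?_).symm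
      rw [Finset.card_pair hij.ne, Finset.card_pair hab.ne]
    obtain ⟨v, hv, hv'⟩ := hex
    exact Ideal.mul_mem_left _ _ ((isPrime_variablesIdeal _).prod_mem_iff.2
      ⟨v, hv', X_mem_variablesIdeal_iff.2 hv⟩)

lemma exists_edge_of_mem_assPrimes [Fintype V] [DecidableEq V] {P : Ideal (MvPolynomial V k)}
    (hP : P ∈ assPrimes (coverIdeal k G)) :
    ∃ i j, G.Adj i j ∧ P = variablesIdeal k {i, j} := by
  classical
  obtain ⟨hPrime, f, hf⟩ := mem_assPrimes_iff.1 hP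
  let E : Finset (V × V) := Finset.univ.filter fun e =>
    G.Adj e.1 e.2 ∧ f ∉ variablesIdeal k {e.1, e.2}
  have hle : E.inf (fun e => variablesIdeal k {e.1, e.2}) ≤ P := by
    intro g hg
    rw [Submodule.mem_finsetInf] at hg
    refine (hf g).2 (mem_coverIdeal_of_forall_edge fun a b hab => ?_)
    by_cases hfab : f ∈ variablesIdeal k {a, b}
    · exact Ideal.mul_mem_left _ _ hfab
    · exact Ideal.mul_mem_right _ _ (hg (a, b) (by simp [E, hab, hfab]))
  obtain ⟨⟨i, j⟩, he, hle'⟩ := (Ideal.IsPrime.inf_le' hPrime).1 hle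
  simp only [E, Finset.mem_filter, Finset.mem_univ, true_and] at he
  refine ⟨i, j, he.1, le_antisymm (fun g hg => ?_) hle'⟩
  exact ((isPrime_variablesIdeal _).mem_or_mem
    (coverIdeal_le_variablesIdeal he.1 ((hf g).1 hg))).resolve_right he.2

end CoverIdeal

lemma mem_localContraction_iff {R : Type*} [CommRing R] {I P : Ideal R} [P.IsPrime] {f : R} :
    f ∈ localContraction I P ↔ ∃ u ∉ P, u * f ∈ I := by
  rw [localContraction, Ideal.mem_comap, IsLocalization.mem_map_algebraMap_iff P.primeCompl]
  constructor
  · rintro ⟨⟨⟨a, ha⟩, u⟩, h⟩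
    rw [← map_mul, IsLocalization.eq_iff_exists P.primeCompl] at h
    obtain ⟨c, hc⟩ := h
    refine ⟨c * u, (c * u).2, ?_⟩
    have : (c : R) * u * f = c * a := by rw [← hc]; ring
    rw [this]
    exact I.mul_mem_left _ ha
  · rintro ⟨u, hu, h⟩
    exact ⟨⟨⟨_, h⟩, ⟨u, hu⟩⟩, by rw [← map_mul, mul_comm]⟩

lemma mem_symbolicPower_iff {R : Type*} [CommRing R] {I : Ideal R} {s : ℕ} {f : R} :
    f ∈ symbolicPower I s ↔ ∀ P ∈ assPrimes I, ∃ u ∉ P, u * f ∈ I ^ s := by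
  simp only [symbolicPower, Ideal.mem_iInf]
  refine forall₂_congr fun P hP => ?_
  have : P.IsPrime := IsAssociatedPrime.isPrime hP
  exact mem_localContraction_iff

section CoverIdeal

variable {k : Type*} [Field k] {V : Type*} [Fintype V] {G : SimpleGraph V}

lemma le_add_of_mem_symbolicPower_coverIdeal {s : ℕ} {f : MvPolynomial V k}
    (hf : f ∈ symbolicPower (coverIdeal k G) s) {m : V →₀ ℕ} (hm : m ∈ f.support)
    {i j : V} (hij : G.Adj i j) : s ≤ m i + m j := by
  classical
  obtain ⟨u, hu, huf⟩ := mem_symbolicPower_iff.1 hf _ (variablesIdeal_mem_assPrimes hij)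
  have h := X_pow_dvd_of_mem_coverIdeal_pow (one_le_card_edge_inter hij) huf
  rw [one_mul, map_mul] at h
  rw [← Finset.sum_pair hij.ne]
  exact le_sum_of_X_pow_dvd_scaleHom
    (Polynomial.prime_X.pow_dvd_of_dvd_mul_left _ (mem_variablesIdeal.not.1 hu) h) hm

lemma monomial_mem_symbolicPower_coverIdeal {s : ℕ} {m : V →₀ ℕ}
    (hm : ∀ i j, G.Adj i j → s ≤ m i + m j) :
    MvPolynomial.monomial m 1 ∈ symbolicPower (coverIdeal k G) s := by
  classical
  refine mem_symbolicPower_iff.2 fun P hP => ?_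
  obtain ⟨i, j, hij, rfl⟩ := exists_edge_of_mem_assPrimes hP
  set w : MvPolynomial V k := ∏ u ∈ ({i, j} : Finset V)ᶜ, MvPolynomial.X u with hw
  refine ⟨w ^ (m i + m j), fun h => prod_compl_notMem_variablesIdeal _
    ((isPrime_variablesIdeal _).mem_of_pow_mem _ h), ?_⟩
  have hi : MvPolynomial.X i * w ∈ coverIdeal k G :=
    X_mul_prod_compl_mem_coverIdeal hij.ne (by simp)
  have hj : MvPolynomial.X j * w ∈ coverIdeal k G :=
    X_mul_prod_compl_mem_coverIdeal hij.ne (by simp)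
  have h1 := Ideal.mul_mem_mul (Ideal.pow_mem_pow hi (m i)) (Ideal.pow_mem_pow hj (m j))
  rw [← pow_add] at h1
  refine Ideal.mem_of_dvd _ ?_ (Ideal.pow_le_pow_right (hm i j hij) h1)
  rw [mul_pow, mul_pow, mul_mul_mul_comm, ← pow_add, mul_comm _ (w ^ _)]
  refine mul_dvd_mul_left _ ?_
  rw [MvPolynomial.monomial_eq, Finsupp.prod_fintype _ _ (fun _ => pow_zero _), map_one, one_mul,
    ← Finset.prod_pair (f := fun v => (MvPolynomial.X v : MvPolynomial V k) ^ m v) hij.ne]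
  exact Finset.prod_dvd_prod_of_subset _ _ _ (Finset.subset_univ _)

end CoverIdeal

/-- A graph with an `n`-colouring admits a `t`-fold weighted colouring for any weight `b ≤ t`
whose sums along edges between vertices of positive weight are at most `2 * t / n`. -/
lemma exists_weighted_coloring {V : Type*} {G : SimpleGraph V} {n : ℕ} (hn : 0 < n)
    (c : G.Coloring (Fin n)) {t w : ℕ} (hw : n * w ≤ 2 * t) (b : V → ℕ) (hbt : ∀ v, b v ≤ t)
    (hb : ∀ u v, G.Adj u v → 0 < b u → 0 < b v → b u + b v ≤ w) :
    ∃ T : V → Finset ℕ, (∀ v, T v ⊆ Finset.range t) ∧ (∀ v, b v ≤ (T v).card) ∧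
      ∀ u v, G.Adj u v → Disjoint (T u) (T v) := by
  classical
  let S : V → Finset ℕ := fun v => (Finset.range t).filter fun q => q % n = c v ∧ q / n < b v
  let B : V → Finset ℕ := fun v =>
    (Finset.range t).filter fun q => ¬ (q % n ≠ c v ∧ q / n < w - b v)
  have hSB : ∀ u v, G.Adj u v → w < 2 * b v → Disjoint (S u) (B v) := by
    intro u v huv hv
    refine Finset.disjoint_left.2 fun q hq hq' => ?_
    simp only [S, B, Finset.mem_filter] at hq hq'
    refine hq'.2 ⟨fun h => c.valid huv (Fin.ext (hq.2.1.symm.trans h)), ?_⟩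
    have := hb u v huv ((Nat.zero_le _).trans_lt hq.2.2) (by omega)
    exact hq.2.2.trans_le (by omega)
  refine ⟨fun v => if 2 * b v ≤ w then S v else B v, fun v => ?_, fun v => ?_, fun u v huv => ?_⟩
  · dsimp only
    split_ifs <;> exact Finset.filter_subset _ _
  · dsimp only
    split_ifs with h
    · have hinj : Function.Injective fun l : ℕ => l * n + (c v : ℕ) := fun x y hxy => by
        simpa [hn.ne'] using hxy
      rw [← Finset.card_range (b v), ← Finset.card_image_of_injective _ hinj]
      refine Finset.card_le_card fun q hq => ?_
      obtain ⟨l, hl, rfl⟩ := Finset.mem_image.1 hq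
      have hl := Finset.mem_range.1 hl
      have hc := (c v).2
      simp only [S, Finset.mem_filter, Finset.mem_range]
      refine ⟨by nlinarith, ?_, ?_⟩
      · rw [mul_comm, Nat.mul_add_mod, Nat.mod_eq_of_lt hc]
      · rw [mul_comm, Nat.mul_add_div hn, Nat.div_eq_of_lt hc]; simpa using hl
    · have hcard : ((Finset.range t).filter fun q => q % n ≠ c v ∧ q / n < w - b v).card ≤
          (n - 1) * (w - b v) := by
        calc _ ≤ (((Finset.range n).erase (c v)) ×ˢ Finset.range (w - b v)).card := by
              refine Finset.card_le_card_of_injOn (fun q => (q % n, q / n)) ?_ ?_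
              · intro q hq
                simp only [Finset.coe_filter, Finset.mem_range, Set.mem_ofPred_eq] at hq
                simpa [hq.2.1, hq.2.2] using Nat.mod_lt _ hn
              · intro x _ y _ hxy
                obtain ⟨h1, h2⟩ := Prod.mk.inj hxy
                rw [← Nat.div_add_mod x n, ← Nat.div_add_mod y n, h1, h2]
          _ = _ := by
              rw [Finset.card_product, Finset.card_erase_of_mem (by simp), Finset.card_range,
                Finset.card_range]
      have hsum := Finset.card_filter_add_card_filter_not (s := Finset.range t)
        (fun q => q % n ≠ c v ∧ q / n < w - b v)
      rw [Finset.card_range] at hsum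
      have hle : (n - 1) * (w - b v) + b v ≤ t := by
        rcases le_total w (b v) with hwb | hwb
        · simpa [Nat.sub_eq_zero_of_le hwb] using hbt v
        · obtain ⟨d, hd⟩ := Nat.exists_eq_add_of_le hwb
          obtain ⟨p, rfl⟩ := Nat.exists_eq_add_of_lt hn
          have : w - b v = d := by omega
          rw [this]
          have hdb : d < b v := by omega
          simp only [zero_add, Nat.add_sub_cancel]
          rw [hd] at hw
          rcases Nat.eq_zero_or_pos p with rfl | hp
          · simpa using hbt v
          · obtain ⟨p, rfl⟩ := Nat.exists_eq_add_of_lt hp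
            have := Nat.mul_le_mul_left p hdb.le
            nlinarith
      have : (B v).card + (n - 1) * (w - b v) ≥ t := by
        simp only [B]; omega
      omega
  · dsimp only
    split_ifs with hu hv hv
    · refine Finset.disjoint_left.2 fun q hq hq' => ?_
      simp only [S, Finset.mem_filter] at hq hq'
      exact c.valid huv (Fin.ext (hq.2.1.symm.trans hq'.2.1))
    · exact hSB u v huv (by omega)
    · exact (hSB v u huv.symm (by omega)).symm
    · have := hb u v huv (by omega) (by omega)
      omega

section Resurgence

variable {k : Type*} [Field k] {V : Type*} [Fintype V] {G : SimpleGraph V}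

lemma symbolicPower_coverIdeal_le_pow {n : ℕ} (hn : 0 < n) (hG : G.Colorable n) {s t : ℕ}
    (h : 2 * t * n ≤ s * n + 2 * t) :
    symbolicPower (coverIdeal k G) s ≤ coverIdeal k G ^ t := by
  classical
  intro f hf
  refine mem_of_forall_monomial_mem fun m hm => ?_
  have hst : n * (2 * t - s) ≤ 2 * t := by
    rw [Nat.mul_sub, Nat.sub_le_iff_le_add]
    linarith
  obtain ⟨c⟩ := hG
  obtain ⟨T, hT, hcard, hdisj⟩ := exists_weighted_coloring hn c hst (fun v => t - m v)
    (fun v => Nat.sub_le _ _) fun u v huv hu hv => by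
      have := le_add_of_mem_symbolicPower_coverIdeal hf hm huv
      omega
  exact monomial_mem_coverIdeal_pow T hT hdisj m
    (fun v => by have := hcard v; omega) _

lemma resurgence_coverIdeal_le {n : ℕ} (hn : 0 < n) (hG : G.Colorable n) :
    resurgence (coverIdeal k G) ≤ ((2 - 2 / (n : ℝ) : ℝ) : EReal) := by
  refine sSup_le ?_
  rintro _ ⟨s, t, _, ht, hst, rfl⟩
  rw [EReal.coe_le_coe_iff]
  contrapose! hst
  refine symbolicPower_coverIdeal_le_pow hn hG ?_
  have hn' : (0 : ℝ) < n := by exact_mod_cast hn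
  have ht' : (0 : ℝ) < t := by exact_mod_cast ht
  have h1 : (2 - 2 / (n : ℝ)) * t * n ≤ s * n :=
    mul_le_mul_of_nonneg_right ((lt_div_iff₀ ht').1 hst).le hn'.le
  have h2 : (2 - 2 / (n : ℝ)) * t * n = 2 * t * n - 2 * t := by field_simp
  have h3 : (2 : ℝ) * t * n ≤ s * n + 2 * t := by linarith
  exact_mod_cast h3

lemma asymptoticResurgence_le_resurgence {R : Type*} [CommRing R] (I : Ideal R) :
    asymptoticResurgence I ≤ resurgence I := by
  refine sSup_le ?_
  rintro _ ⟨s, t, hs, ht, h, rfl⟩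
  obtain ⟨r, hr, hr0⟩ := (h.and (Filter.eventually_gt_atTop 0)).exists
  refine le_sSup ⟨s * r, t * r, by positivity, by positivity, hr, ?_⟩
  have : (r : ℝ) ≠ 0 := by exact_mod_cast hr0.ne'
  rw [Nat.cast_mul, Nat.cast_mul, mul_div_mul_right _ _ this]

/-- If every vertex cover meets `A` in at least `d` vertices, then the asymptotic resurgence of
the cover ideal is at least `2 * d / |A|`. -/
lemma le_asymptoticResurgence_coverIdeal [DecidableEq V] {A : Finset V} {d : ℕ} (hd : 0 < d)
    (hA : 0 < A.card)
    (h : ∀ C : Finset V, G.IsVertexCover (C : Set V) → d ≤ (A ∩ C).card) :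
    ((2 * d / A.card : ℝ) : EReal) ≤ asymptoticResurgence (coverIdeal k G) := by
  have hlim : Filter.Tendsto
      (fun p : ℕ => (((2 * d * (p + 1) : ℕ) / (A.card * (p + 1) + 1 : ℕ) : ℝ) : EReal))
      Filter.atTop (nhds ((2 * d / A.card : ℝ) : EReal)) := by
    refine EReal.tendsto_coe.2 ?_
    have hA' : (A.card : ℝ) ≠ 0 := by exact_mod_cast hA.ne'
    have h0 : Filter.Tendsto (fun p : ℕ => 2 * d / ((A.card : ℝ) + 1 / ((p : ℝ) + 1)))
        Filter.atTop (nhds (2 * d / ((A.card : ℝ) + 0))) :=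
      tendsto_const_nhds.div (tendsto_const_nhds.add tendsto_one_div_add_atTop_nhds_zero_nat)
        (by simpa using hA')
    rw [add_zero] at h0
    refine h0.congr fun p => ?_
    have hp : (p : ℝ) + 1 ≠ 0 := by positivity
    push_cast
    rw [← mul_div_mul_right _ _ hp, add_mul, one_div_mul_cancel hp]
  refine le_of_tendsto' hlim fun p => le_sSup ⟨_, _, by positivity, by positivity, ?_, rfl⟩
  filter_upwards [Filter.eventually_gt_atTop 0] with r hr hle
  let m : V →₀ ℕ := Finsupp.equivFunOnFinite.symm
    fun v => if v ∈ A then d * (p + 1) * r else 2 * d * (p + 1) * r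
  have hm : MvPolynomial.monomial m 1 ∈ symbolicPower (coverIdeal k G) (2 * d * (p + 1) * r) := by
    refine monomial_mem_symbolicPower_coverIdeal fun i j _ => ?_
    have h1 : ∀ v, d * (p + 1) * r ≤ m v := fun v => by
      simp only [m, Finsupp.equivFunOnFinite_symm_apply_apply]
      split_ifs <;> nlinarith [Nat.zero_le (d * (p + 1) * r)]
    linarith [h1 i, h1 j]
  have h2 := le_sum_of_X_pow_dvd_scaleHom (X_pow_dvd_of_mem_coverIdeal_pow h (hle hm)) (m := m)
    (by simp [MvPolynomial.mem_support_iff])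
  have h3 : ∑ v ∈ A, m v = A.card * (d * (p + 1) * r) := by
    rw [Finset.sum_congr rfl fun v hv =>
      show m v = d * (p + 1) * r by simp [m, hv], Finset.sum_const, smul_eq_mul]
  rw [h3] at h2
  have : 0 < d * r := by positivity
  nlinarith

lemma two_sub_le_asymptoticResurgence_coverIdeal [DecidableEq V] {A : Finset V} {b : ℕ}
    (hb : b < A.card)
    (h : ∀ S : Finset V, G.IsIndepSet (S : Set V) → S ⊆ A → S.card ≤ b) :
    ((2 - 2 * b / A.card : ℝ) : EReal) ≤ asymptoticResurgence (coverIdeal k G) := by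
  have h1 := le_asymptoticResurgence_coverIdeal (k := k) (G := G) (A := A) (d := A.card - b)
    (by omega) (by omega) fun C hC => by
      have h2 := h (A \ C) (fun u hu v hv _ huv => by
        rcases hC huv with h | h
        · exact (Finset.mem_sdiff.1 hu).2 h
        · exact (Finset.mem_sdiff.1 hv).2 h) Finset.sdiff_subset
      have h3 := Finset.card_sdiff_add_card_inter A C
      omega
  convert h1 using 2
  have hA : (A.card : ℝ) ≠ 0 := by
    have : A.card ≠ 0 := by omega
    exact_mod_cast this
  rw [Nat.cast_sub hb.le]
  field_simp

end Resurgence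

section Resurgence

variable {k : Type*} [Field k] {V : Type*} [Fintype V] {G : SimpleGraph V}

lemma two_sub_cliqueNum_le_asymptoticResurgence_coverIdeal {v w : V} (hvw : G.Adj v w) :
    ((2 - 2 / (G.cliqueNum : ℝ) : ℝ) : EReal) ≤ asymptoticResurgence (coverIdeal k G) := by
  classical
  obtain ⟨A, hA⟩ := G.exists_isNClique_cliqueNum
  have h2 : 2 ≤ G.cliqueNum := by
    rw [← Finset.card_pair hvw.ne]
    exact SimpleGraph.IsClique.card_le_cliqueNum
      (tc := by simpa [SimpleGraph.isClique_pair] using fun _ => hvw)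
  have h := two_sub_le_asymptoticResurgence_coverIdeal (k := k) (G := G) (A := A) (b := 1)
    (by rw [hA.card_eq]; omega) fun S hS hSA => by
      refine Finset.card_le_one.2 fun x hx y hy => ?_
      by_contra hxy
      exact hS hx hy hxy (hA.isClique (hSA hx) (hSA hy) hxy)
  simpa [hA.card_eq] using h

lemma two_sub_indepNum_le_asymptoticResurgence_coverIdeal {v w : V} (hvw : G.Adj v w) :
    ((2 - 2 * (G.indepNum : ℝ) / (Fintype.card V : ℝ) : ℝ) : EReal) ≤
      asymptoticResurgence (coverIdeal k G) := by
  classical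
  have h := two_sub_le_asymptoticResurgence_coverIdeal (k := k) (G := G) (A := Finset.univ)
    (b := G.indepNum) (by
      obtain ⟨S, hS⟩ := G.exists_isNIndepSet_indepNum
      rw [← hS.card_eq]
      refine Finset.card_lt_card (Finset.ssubset_univ_iff.2 ?_)
      rintro rfl
      exact hS.isIndepSet (by simp) (by simp) hvw.ne hvw)
    fun S hS _ => SimpleGraph.IsIndepSet.card_le_indepNum hS
  simpa using h

lemma resurgence_coverIdeal_le_chromaticNumber [Nonempty V] :
    resurgence (coverIdeal k G) ≤ ((2 - 2 / (G.chromaticNumber.toNat : ℝ) : ℝ) : EReal) := by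
  have hne : G.chromaticNumber ≠ ⊤ :=
    SimpleGraph.chromaticNumber_ne_top_iff_exists.2 ⟨_, G.colorable_of_fintype⟩
  have hc : G.Colorable G.chromaticNumber.toNat :=
    G.colorable_chromaticNumber G.colorable_of_fintype
  refine resurgence_coverIdeal_le (Nat.pos_of_ne_zero fun h0 => ?_) hc
  rw [h0] at hc
  obtain ⟨c⟩ := hc
  exact (c (Classical.arbitrary V)).elim0

lemma resurgence_coverIdeal_eq [Nonempty V] {v w : V} (hvw : G.Adj v w)
    (h : G.chromaticNumber = (G.cliqueNum : ℕ∞)) :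
    asymptoticResurgence (coverIdeal k G) = ((2 - 2 / (G.cliqueNum : ℝ) : ℝ) : EReal) ∧
      resurgence (coverIdeal k G) = ((2 - 2 / (G.cliqueNum : ℝ) : ℝ) : EReal) := by
  have h1 := two_sub_cliqueNum_le_asymptoticResurgence_coverIdeal (k := k) hvw
  have h2 := asymptoticResurgence_le_resurgence (coverIdeal k G)
  have h3 := resurgence_coverIdeal_le_chromaticNumber (k := k) (G := G)
  rw [h, ENat.toNat_natCast] at h3
  exact ⟨le_antisymm (h2.trans h3) h1, le_antisymm h3 (h1.trans h2)⟩

lemma IsPerfectGraph.chromaticNumber_eq_cliqueNum (h : IsPerfectGraph G) :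
    G.chromaticNumber = (G.cliqueNum : ℕ∞) := by
  have h1 := h Set.univ
  rw [SimpleGraph.chromaticNumber_congr (SimpleGraph.induceUnivIso G)] at h1
  refine le_antisymm (h1.le.trans ?_) SimpleGraph.cliqueNum_le_chromaticNumber
  exact_mod_cast SimpleGraph.cliqueNum_induce_le Set.univ

end Resurgence

theorem mainTheorem1 (k : Type*) [Field k] {V : Type*} [Fintype V] [Nonempty V]
    (G : SimpleGraph V) (hG : ∀ v : V, ∃ w : V, G.Adj v w) :
    (G.Connected →
      ((max (2 - 2 / (G.cliqueNum : ℝ))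
          (2 - 2 * (G.indepNum : ℝ) / (Fintype.card V : ℝ)) : ℝ) : EReal)
          ≤ asymptoticResurgence (coverIdeal k G) ∧
        asymptoticResurgence (coverIdeal k G) ≤ resurgence (coverIdeal k G) ∧
        resurgence (coverIdeal k G)
          ≤ ((2 - 2 / (G.chromaticNumber.toNat : ℝ) : ℝ) : EReal)) ∧
    (G.chromaticNumber = (G.cliqueNum : ℕ∞) →
      asymptoticResurgence (coverIdeal k G) = ((2 - 2 / (G.cliqueNum : ℝ) : ℝ) : EReal) ∧
        resurgence (coverIdeal k G) = ((2 - 2 / (G.cliqueNum : ℝ) : ℝ) : EReal)) ∧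
    (IsPerfectGraph G →
      asymptoticResurgence (coverIdeal k G) = ((2 - 2 / (G.cliqueNum : ℝ) : ℝ) : EReal) ∧
        resurgence (coverIdeal k G) = ((2 - 2 / (G.cliqueNum : ℝ) : ℝ) : EReal)) := by

  obtain ⟨v⟩ := ‹Nonempty V›
  have : Nonempty V := ⟨v⟩
  obtain ⟨w, hvw⟩ := hG v
  refine ⟨fun _ => ⟨?_, asymptoticResurgence_le_resurgence _,
    resurgence_coverIdeal_le_chromaticNumber⟩, resurgence_coverIdeal_eq hvw,
    fun h => resurgence_coverIdeal_eq hvw h.chromaticNumber_eq_cliqueNum⟩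
  rcases max_choice (2 - 2 / (G.cliqueNum : ℝ))
    (2 - 2 * (G.indepNum : ℝ) / (Fintype.card V : ℝ)) with h | h <;> rw [h]
  · exact two_sub_cliqueNum_le_asymptoticResurgence_coverIdeal hvw
  · exact two_sub_indepNum_le_asymptoticResurgence_coverIdeal hvw
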